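/- Let $K$ be a number field with ring of integers $O_K$, let $\pi$ be a nonzero prime ideal of $O_K$, let $O_K[\frac1\pi]$ be the ring of elements of $K$ that are integral at every prime of $O_K$ other than $\pi$, let $\ell$ be a prime number with $\ell\notin\pi$, and let $i\ge 0$ be a real number. Let $K_\pi$ be the completion of $K$ at $\pi$. For a finite Galois extension $L/K_\pi$ with Galois group $G$, valuation ring $O_L$ and normalized valuation $v_L$, put $G_s=\{\sigma\in G : v_L(\sigma x-x)\ge s+1 \text{ for all } x\in O_L\}$ for real $s\ge -1$, let $\varphi_{L/K_\pi}(u)=\int_0^u \frac{dt}{[G_0:G_t]}$ (so $\varphi_{L/K_\pi}(u)=u$ for $-1\le u\le 0$), and let $\mathrm{Gal}(L/K_\pi)^{v}=G_{\varphi_{L/K_\pi}^{-1}(v)}$. Let $\mathrm{Gal}(\overline{K}_\pi/K_\pi)^v=\varprojlim_L \mathrm{Gal}(L/K_\pi)^v$ be the ramification groups in the upper numbering. A commutative group scheme $J$ over $O_K[\frac1\pi]$ is called *ramified of level $i$ at $\pi$* if, for every $K$-embedding $\overline{K}\to\overline{K}_\pi$ and every real $v>i$, the group $\mathrm{Gal}(\overline{K}_\pi/K_\pi)^v$,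 mapped to $\mathrm{Gal}(\overline{K}/K)$ by restriction along this embedding, acts trivially on $J(\overline{K})$. Let $\mathscr{C}$ be the category of finite flat commutative group schemes over $O_K[\frac1\pi]$ whose order is a power of $\ell$ and that are ramified of level $i$ at $\pi$; its morphisms are the homomorphisms of group schemes over $O_K[\frac1\pi]$. A sequence $0\to N\to J\to Q\to 0$ of commutative group schemes over $O_K[\frac1\pi]$ is called exact if $J\to Q$ is faithfully flat and quasi-compact and $N\to J$ is its kernel; then $J$ is an *extension* of $Q$ by $N$, and $Q$ is a *quotient* of $J$ by $N$. Then: 1. If $0\to J''\to J\to J'\to 0$ is an exact sequence of commutative group schemes over $O_K[\frac1\pi]$ and $J''$ and $J'$ are in $\mathscr{C}$, then $J$ is in $\mathscr{C}$. 2. If $J$ is in $\mathscr{C}$ and $H\to J$ is a closed subgroup scheme that is flat over $O_K[\frac1\pi]$, then $H$ is in $\mathscr{C}$, and every quotient $Q$ of $J$ by $H$ is in $\mathscr{C}$. -/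

import Mathlib

open CategoryTheory AlgebraicGeometry MonoidalCategory CartesianMonoidalCategory
open NumberField IsDedekindDomain
open scoped MonObj

noncomputable section

universe u

/-! ### Ramification groups -/

section Ramification

variable (O F L : Type*) [CommRing O] [Field F] [Field L] [Algebra O F] [IsFractionRing O F]
  [Algebra F L] [Algebra O L] [IsScalarTower O F L] [Algebra.IsAlgebraic F L]

/-- The ramification group `G_s` (lower numbering, real index `s ≥ -1`) of a finite Galois extension
`L / F` of local fields, where `O` is the valuation ring of `F`: the `σ` with
`σ x - x ∈ 𝔪 ^ (⌈s⌉ + 1)` for all `x` in the valuation ring `B` of `L`, i.e. `v_L (σ x - x) ≥ s + 1`.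
Here `B` is the integral closure of `O` in `L`; as `B` is local, its maximal ideal `𝔪` is its
Jacobson radical. -/
def lowerRamificationGroup (s : ℝ) : Subgroup (L ≃ₐ[F] L) :=
  letI : MulSemiringAction (L ≃ₐ[F] L) (integralClosure O L) :=
    IsIntegralClosure.MulSemiringAction O F L (integralClosure O L)
  ((Ring.jacobson (integralClosure O L)) ^ ⌈s + 1⌉₊).inertia (L ≃ₐ[F] L)

/-- The Herbrand function `φ(u) = ∫₀ᵘ dt / [G_0 : G_t]`. For `-1 < t ≤ 0` the integrand is `1`, so
that `φ(u) = u` for `-1 ≤ u ≤ 0`. -/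
def herbrandPhi (u : ℝ) : ℝ :=
  ∫ t in (0 : ℝ)..u, (((lowerRamificationGroup O F L t).relIndex
    (lowerRamificationGroup O F L 0) : ℕ) : ℝ)⁻¹

/-- The inverse `ψ` of the Herbrand function, which is an increasing bijection of the real line
for a finite extension. -/
def herbrandPsi : ℝ → ℝ := Function.invFun (herbrandPhi O F L)

/-- The ramification group with upper numbering `G^v = G_{ψ(v)}` of a finite Galois extension. -/
def upperRamificationGroup (v : ℝ) : Subgroup (L ≃ₐ[F] L) :=
  lowerRamificationGroup O F L (herbrandPsi O F L v)

end Ramification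

section AbsoluteRamification

variable (O F : Type*) [CommRing O] [Field F] [Algebra O F] [IsFractionRing O F]

/-- The ramification group with upper numbering `G^v` of the absolute Galois group of the local
field `F` with valuation ring `O`: the inverse limit of the groups `Gal(L/F)^v` over the finite
Galois extensions `L / F`. -/
def absoluteUpperRamificationGroup (v : ℝ) :
    Subgroup (AlgebraicClosure F ≃ₐ[F] AlgebraicClosure F) :=
  ⨅ L : FiniteGaloisIntermediateField F (AlgebraicClosure F),
    (upperRamificationGroup O F L v).comap (AlgEquiv.restrictNormalHom L)

/-- A representation `ρ` of the absolute Galois group of the local field `F` is ramified of level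
`i` if `ker ρ` contains the upper ramification groups `G^v` for all real `v > i`. -/
def IsRamifiedOfLevel {M : Type*} [Group M]
    (ρ : (AlgebraicClosure F ≃ₐ[F] AlgebraicClosure F) →* M) (i : ℝ) : Prop :=
  ∀ v : ℝ, i < v → absoluteUpperRamificationGroup O F v ≤ ρ.ker

end AbsoluteRamification

/-- Restriction of Galois groups `Gal(F̄/F) → Gal(K̄/K)` along a `K`-embedding `e : K̄ → F̄`.
If `F` is the completion of the number field `K` at a prime `𝔮`, this is an isomorphism onto a
decomposition group of `𝔮`, and every decomposition group of `𝔮` arises from some `e`. -/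
def galoisRestrict {K F : Type*} [Field K] [Field F] [Algebra K F]
    (e : AlgebraicClosure K →ₐ[K] AlgebraicClosure F) :
    (AlgebraicClosure F ≃ₐ[F] AlgebraicClosure F) →*
      (AlgebraicClosure K ≃ₐ[K] AlgebraicClosure K) :=
  letI : Algebra (AlgebraicClosure K) (AlgebraicClosure F) := e.toRingHom.toAlgebra
  haveI : IsScalarTower K (AlgebraicClosure K) (AlgebraicClosure F) :=
    IsScalarTower.of_algebraMap_eq' e.comp_algebraMap.symm
  (AlgEquiv.restrictNormalHom (AlgebraicClosure K)).comp (AlgEquiv.restrictScalarsHom K)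

theorem galoisRestrict_commutes {K F : Type*} [Field K] [Field F] [Algebra K F]
    (e : AlgebraicClosure K →ₐ[K] AlgebraicClosure F)
    (σ : AlgebraicClosure F ≃ₐ[F] AlgebraicClosure F) (x : AlgebraicClosure K) :
    e (galoisRestrict e σ x) = σ (e x) := by
  let : Algebra (AlgebraicClosure K) (AlgebraicClosure F) := e.toRingHom.toAlgebra
  have : IsScalarTower K (AlgebraicClosure K) (AlgebraicClosure F) :=
    IsScalarTower.of_algebraMap_eq' e.comp_algebraMap.symm
  exact AlgEquiv.restrictNormal_commutes (AlgEquiv.restrictScalars K σ) (AlgebraicClosure K) x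

/-! ### Group schemes over the ring of `π`-integers -/

section GroupSchemes

variable {K : Type u} [Field K] [NumberField K] (π : HeightOneSpectrum (𝓞 K))

/-- The ring `O_K[1/π]` of `π`-integers of `K`: the elements integral at all primes except `π`. -/
abbrev PiInteger : Type u := ({π} : Set (HeightOneSpectrum (𝓞 K))).integer K

/-- The category of commutative group schemes over `O_K[1/π]`. -/
abbrev CommGroupScheme : Type (u + 1) :=
  CommGrp (Over (Spec (CommRingCat.of (PiInteger π))))

/-- `Spec K̄` as a scheme over `O_K[1/π]`. -/
def geometricPoint : Over (Spec (CommRingCat.of (PiInteger π))) :=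
  Over.mk (Spec.map (CommRingCat.ofHom (algebraMap (PiInteger π) (AlgebraicClosure K))))

/-- The endomorphism of `Spec K̄` over `O_K[1/π]` induced by `σ ∈ Gal(K̄/K)`. -/
def geometricPointMap (σ : AlgebraicClosure K ≃ₐ[K] AlgebraicClosure K) :
    geometricPoint π ⟶ geometricPoint π :=
  Over.homMk (Spec.map (CommRingCat.ofHom (σ : AlgebraicClosure K →+* AlgebraicClosure K))) (by
    simp only [geometricPoint, Over.mk_hom, Over.mk_left, ← Spec.map_comp, ← CommRingCat.ofHom_comp]
    congr 2
    ext x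
    exact σ.commutes (x : K))

theorem geometricPointMap_one :
    geometricPointMap π (1 : AlgebraicClosure K ≃ₐ[K] AlgebraicClosure K) = 𝟙 _ :=
  Over.OverMorphism.ext (Spec.map_id _)

theorem geometricPointMap_mul (σ τ : AlgebraicClosure K ≃ₐ[K] AlgebraicClosure K) :
    geometricPointMap π (σ * τ) = geometricPointMap π σ ≫ geometricPointMap π τ :=
  Over.OverMorphism.ext (Spec.map_comp
    (CommRingCat.ofHom (τ : AlgebraicClosure K →+* AlgebraicClosure K))
    (CommRingCat.ofHom (σ : AlgebraicClosure K →+* AlgebraicClosure K)))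

variable {π}

/-- The representation `ρ_J : Gal(K̄/K) → Aut(J(K̄))` given by the natural action of the Galois group
on the group `J(K̄)` of geometric points. -/
def galoisRep (J : CommGroupScheme π) :
    (AlgebraicClosure K ≃ₐ[K] AlgebraicClosure K) →* MulAut (geometricPoint π ⟶ J.X) where
  toFun σ :=
    { toFun := fun P => geometricPointMap π σ ≫ P
      invFun := fun P => geometricPointMap π σ⁻¹ ≫ P
      left_inv := fun P => by
        change geometricPointMap π σ⁻¹ ≫ geometricPointMap π σ ≫ P = P
        rw [← Category.assoc, ← geometricPointMap_mul, inv_mul_cancel, geometricPointMap_one,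
          Category.id_comp]
      right_inv := fun P => by
        change geometricPointMap π σ ≫ geometricPointMap π σ⁻¹ ≫ P = P
        rw [← Category.assoc, ← geometricPointMap_mul, mul_inv_cancel, geometricPointMap_one,
          Category.id_comp]
      map_mul' := fun P Q => MonObj.comp_mul _ P Q }
  map_one' := by
    ext P : 1
    change geometricPointMap π 1 ≫ P = P
    rw [geometricPointMap_one, Category.id_comp]
  map_mul' σ τ := by
    ext P : 1
    change geometricPointMap π (σ * τ) ≫ P = geometricPointMap π σ ≫ geometricPointMap π τ ≫ P
    rw [geometricPointMap_mul, Category.assoc]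

/-- `J` is ramified of level `i` at the prime `𝔮` of `K`: the restriction of `ρ_J` to a
decomposition group of `𝔮` is ramified of level `i`. (All decomposition groups of `𝔮` are conjugate,
so that it does not matter whether one takes one or all of them.) -/
def CommGroupScheme.IsRamifiedOfLevelAt (J : CommGroupScheme π) (𝔮 : HeightOneSpectrum (𝓞 K))
    (i : ℝ) : Prop :=
  ∀ e : AlgebraicClosure K →ₐ[K] AlgebraicClosure (𝔮.adicCompletion K),
    IsRamifiedOfLevel (𝔮.adicCompletionIntegers K) (𝔮.adicCompletion K)
      ((galoisRep J).comp (galoisRestrict e)) i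

variable (π) in
/-- The objects of the category of finite flat commutative group schemes `J` over `O_K[1/π]` of
`ℓ`-power order (the rank of the structure sheaf is a power of `ℓ`) that are ramified of level `i`
at `π`. The category is the full subcategory of `CommGroupScheme π` on these objects. -/
structure IsLevelGroupScheme (ℓ : ℕ) (i : ℝ) (J : CommGroupScheme π) : Prop where
  isFinite : IsFinite J.X.hom
  flat : Flat J.X.hom
  order : ∃ n : ℕ, ∀ s, J.X.hom.finrank s = ℓ ^ n
  level : J.IsRamifiedOfLevelAt π i

/-- The underlying morphism of schemes of a homomorphism of group schemes. -/
abbrev CommGroupScheme.homLeft {G H : CommGroupScheme π} (f : G ⟶ H) : G.X.left ⟶ H.X.left :=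
  f.hom.hom.hom.left

/-- `0 ⟶ N ⟶ J ⟶ Q ⟶ 0` (with the given homomorphisms `f` and `g`) is a short exact sequence of
commutative group schemes: `f` is a kernel of `g`, i.e. `N` is the fibre product of `J` and the unit
section over `Q`, and `g` is faithfully flat and quasi-compact. In other words, `J` is an
extension of `Q` by `N`, and `Q` is a quotient of `J` by `N`. -/
structure IsShortExactSeq {N J Q : CommGroupScheme π} (f : N ⟶ J) (g : J ⟶ Q) : Prop where
  isKernel : IsPullback f.hom.hom.hom (toUnit N.X) g.hom.hom.hom η[Q.X]
  flat : Flat (CommGroupScheme.homLeft g)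
  surjective : Surjective (CommGroupScheme.homLeft g)
  quasiCompact : QuasiCompact (CommGroupScheme.homLeft g)

end GroupSchemes

end

/-! ### Wild inertia and upper numbering -/

section Inertia

variable {B G : Type*} [CommRing B] [Group G] [MulSemiringAction G B]

/-! Three properties must pass through an exact sequence `0 → N → J → Q → 0`: finite flatness, order
a power of `ℓ`, and the ramification bound.

Finite flatness: `J` is an `N`-torsor over `Q`, so `J ×_Q J ≅ J × N`, and `J → Q` is finite by
faithfully flat descent (`isFinite_of_isPullback`). For an extension, compose. For a quotient,
descend from `J` (`isFinite_of_isFinite_comp`, which needs the base Noetherian, and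
`flat_of_flat_comp_of_surjective`).

Order: by Cartier's theorem in characteristic zero the order equals the number of geometric points
(`finrank_eq_card_points`), and these form an exact sequence of groups, so Lagrange's theorem
applies.

Ramification: subgroups and quotients of `J(K̄)` inherit a trivial action. For extensions, take `σ`
in an upper ramification group of index `v > i` and a point `P` of `J`. Then `σ P = P Z` with `Z`
from `N`, and `Z` is fixed by `σ`, so `σ ^ k` sends `P` to `P Z ^ k`; hence `σ ^ (ℓ ^ n)` fixes `P`.
As `v > 0`, `σ` is wild, and the wild group has no `ℓ`-torsion in finite quotients because `ℓ` is a
unit at `π`; so `σ` itself fixes `P`. -/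

theorem smul_sub_mem_pow_succ {I : Ideal B} {σ : G} (hσ : ∀ x : B, σ • x - x ∈ I ^ 2) (j : ℕ) :
    ∀ a ∈ I ^ j, σ • a - a ∈ I ^ (j + 1) := by
  induction j with
  | zero => exact fun a _ => Ideal.pow_le_pow_right (by norm_num) (hσ a)
  | succ j ih =>
    intro a ha
    rw [pow_succ] at ha
    induction ha using Submodule.mul_induction_on' with
    | mem_mul_mem b hb c hc =>
      have hb' : σ • b ∈ I ^ j := by
        have := add_mem (Ideal.pow_le_pow_right (Nat.le_succ j) (ih b hb)) hb
        rwa [sub_add_cancel] at this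
      -- Twisted Leibniz rule: `σ(bc) - bc = σb (σc - c) + (σb - b) c`.
      have h1 : σ • b * (σ • c - c) ∈ I ^ (j + 1 + 1) := by
        rw [add_assoc, pow_add]
        exact Ideal.mul_mem_mul hb' (hσ c)
      have h2 : (σ • b - b) * c ∈ I ^ (j + 1 + 1) := by
        rw [pow_succ]
        exact Ideal.mul_mem_mul (ih b hb) hc
      have := add_mem h1 h2
      rw [smul_mul']
      convert this using 1
      ring
    | add x _ y _ hx hy =>
      have := add_mem hx hy
      rw [smul_add]
      convert this using 1
      ring

/-- An element of the wild inertia group whose order is invertible acts trivially. -/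
theorem smul_eq_of_pow_eq_one [IsNoetherianRing B] {I : Ideal B} (hI : I ≤ Ideal.jacobson ⊥)
    {σ : G} (hσ : ∀ x : B, σ • x - x ∈ I ^ 2) {m : ℕ} (hm : IsUnit (m : B)) (h1 : σ ^ m = 1)
    (x : B) : σ • x = x := by
  have stable : ∀ j, ∀ a ∈ I ^ j, σ • a ∈ I ^ j := fun j a ha => by
    have := add_mem (Ideal.pow_le_pow_right (Nat.le_succ j) (smul_sub_mem_pow_succ hσ j a ha)) ha
    rwa [sub_add_cancel] at this
  have key : ∀ j, σ • x - x ∈ I ^ j := by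
    intro j
    induction j with
    | zero => simp
    | succ j ih =>
      -- Modulo `I ^ (j + 1)`, `σ` fixes `σ x - x`, so the iterates of `x` form an arithmetic
      -- progression. At `k = m` it returns to `x`, and the unit `m` cancels.
      have hk : ∀ k : ℕ, σ ^ k • x - x - k * (σ • x - x) ∈ I ^ (j + 1) := by
        intro k
        induction k with
        | zero => simp
        | succ k ihk =>
          have := add_mem (stable _ _ ihk)
            (Ideal.mul_mem_left _ (k : B) (smul_sub_mem_pow_succ hσ j _ ih))
          have hc : σ • (k : B) = k := map_natCast (MulSemiringAction.toRingHom G B σ) k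
          convert this using 1
          rw [pow_succ', mul_smul]
          simp only [smul_sub, smul_mul', hc]
          push_cast
          ring
      have := hk m
      rw [h1, one_smul, sub_self, zero_sub, neg_mem_iff] at this
      exact (Ideal.unit_mul_mem_iff_mem _ hm).1 this
  -- Krull's intersection theorem.
  have hbot := Ideal.iInf_pow_smul_eq_bot_of_le_jacobson (M := B) I hI
  have : σ • x - x ∈ (⨅ j : ℕ, I ^ j • ⊤ : Submodule B B) := by
    rw [Submodule.mem_iInf]
    intro j
    simpa using key j
  rw [hbot, Submodule.mem_bot] at this
  exact sub_eq_zero.1 this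

end Inertia

/-! ### Ramification groups of positive index over a local base. -/

section LocalRamification

variable (O F L : Type*) [CommRing O] [Field F] [Field L] [Algebra O F] [IsFractionRing O F]
  [Algebra F L] [Algebra O L] [IsScalarTower O F L]

theorem lowerRamificationGroup_antitone [Algebra.IsAlgebraic F L] :
    Antitone (lowerRamificationGroup O F L) := by
  intro s t hst σ hσ x
  exact Ideal.pow_le_pow_right (Nat.ceil_mono (by linarith)) (hσ x)

theorem eq_one_of_mem_lowerRamificationGroup [IsDomain O] [IsIntegrallyClosed O]
    [IsNoetherianRing O] [FiniteDimensional F L] [Algebra.IsSeparable F L]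
    {s : ℝ} (hs : 0 < s) {σ : L ≃ₐ[F] L} (hσ : σ ∈ lowerRamificationGroup O F L s)
    {m : ℕ} (hm : IsUnit (m : O)) (h1 : σ ^ m = 1) : σ = 1 := by
  let : MulSemiringAction (L ≃ₐ[F] L) (integralClosure O L) :=
    IsIntegralClosure.MulSemiringAction O F L (integralClosure O L)
  have : IsNoetherianRing (integralClosure O L) := IsIntegralClosure.isNoetherianRing O F L (integralClosure O L)
  have hm' : IsUnit (m : integralClosure O L) := by
    simpa using hm.map (algebraMap O (integralClosure O L))
  -- Any real index above `0` rounds up to the exponent `2` of wild inertia.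
  have h2 : 2 ≤ ⌈s + 1⌉₊ := Nat.lt_ceil.2 (by push_cast; linarith)
  have key : ∀ x : integralClosure O L, σ • x = x :=
    smul_eq_of_pow_eq_one (I := Ring.jacobson (integralClosure O L))
      (Ideal.jacobson_bot (R := integralClosure O L)).ge
      (fun x => Ideal.pow_le_pow_right h2 (hσ x)) hm' h1
  apply (galRestrict O F L (integralClosure O L)).injective
  ext x : 1
  rw [map_one]
  exact key x

theorem inv_relIndex_antitone [FiniteDimensional F L] :
    Antitone fun t : ℝ => (((lowerRamificationGroup O F L t).relIndex
      (lowerRamificationGroup O F L 0) : ℕ) : ℝ)⁻¹ := by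
  intro s t hst
  have hpos : ∀ t, 0 < (lowerRamificationGroup O F L t).relIndex
      (lowerRamificationGroup O F L 0) := fun t => Nat.pos_of_ne_zero Subgroup.index_ne_zero_of_finite
  exact inv_anti₀ (by exact_mod_cast hpos s) (by
    exact_mod_cast Subgroup.relIndex_le_of_le_left (lowerRamificationGroup_antitone O F L hst)
      (hpos t).ne')

/-- Since `herbrandPsi` is a bare choice of preimage, `v` must first be shown to be a value of `φ`.
The integrand is at least `c = 1 / |G|`, so `φ (v / c) ≥ v` and the intermediate value theorem
applies. A nonpositive preimage is excluded because `φ ≤ 0` there. -/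
theorem herbrandPsi_pos [FiniteDimensional F L] {v : ℝ} (hv : 0 < v) :
    0 < herbrandPsi O F L v := by
  have hint : ∀ a b : ℝ, IntervalIntegrable (fun t : ℝ =>
      (((lowerRamificationGroup O F L t).relIndex
      (lowerRamificationGroup O F L 0) : ℕ) : ℝ)⁻¹) MeasureTheory.volume a b := fun a b =>
    (inv_relIndex_antitone O F L).intervalIntegrable
  set c : ℝ := (Nat.card (L ≃ₐ[F] L) : ℝ)⁻¹ with hc
  have hcpos : 0 < c := inv_pos.2 (by exact_mod_cast Nat.card_pos)
  have hlow : ∀ t : ℝ, c ≤ (((lowerRamificationGroup O F L t).relIndex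
      (lowerRamificationGroup O F L 0) : ℕ) : ℝ)⁻¹ := by
    intro t
    refine inv_anti₀ (by exact_mod_cast Nat.pos_of_ne_zero Subgroup.index_ne_zero_of_finite) ?_
    have h1 : (lowerRamificationGroup O F L t).relIndex (lowerRamificationGroup O F L 0) ≤
        Nat.card (lowerRamificationGroup O F L 0) :=
      Nat.le_of_dvd Nat.card_pos (Subgroup.relIndex_dvd_card _ _)
    have h2 : Nat.card (lowerRamificationGroup O F L 0) ≤ Nat.card (L ≃ₐ[F] L) :=
      Subgroup.card_le_card_group _
    exact_mod_cast h1.trans h2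
  have hcont : Continuous (herbrandPhi O F L) := intervalIntegral.continuous_primitive hint 0
  have hzero : herbrandPhi O F L 0 = 0 := intervalIntegral.integral_same
  have hbig : v ≤ herbrandPhi O F L (v / c) := by
    have h := intervalIntegral.integral_mono_on (a := 0) (b := v / c) (by positivity)
      (intervalIntegrable_const (c := c)) (hint 0 (v / c)) (fun t _ => hlow t)
    rwa [intervalIntegral.integral_const, sub_zero, smul_eq_mul, div_mul_cancel₀ _ hcpos.ne'] at h
  obtain ⟨u, -, hu⟩ := intermediate_value_Icc (by positivity : 0 ≤ v / c) hcont.continuousOn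
    (show v ∈ Set.Icc _ _ from ⟨hzero.trans_le hv.le, hbig⟩)
  have hinv : herbrandPhi O F L (herbrandPsi O F L v) = v :=
    Function.invFun_eq (f := herbrandPhi O F L) ⟨u, hu⟩
  by_contra! hneg
  have : 0 ≤ ∫ t in herbrandPsi O F L v..(0 : ℝ), (((lowerRamificationGroup O F L t).relIndex
      (lowerRamificationGroup O F L 0) : ℕ) : ℝ)⁻¹ :=
    intervalIntegral.integral_nonneg hneg fun t _ => by positivity
  rw [intervalIntegral.integral_symm] at this
  change 0 ≤ - herbrandPhi O F L (herbrandPsi O F L v) at this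
  linarith

/-- Upper ramification groups of positive index have no `ℓ`-torsion if `ℓ` is invertible. -/
theorem exists_coprime_pow_eq_one_of_mem_upperRamificationGroup [IsDomain O] [IsIntegrallyClosed O]
    [IsNoetherianRing O] [FiniteDimensional F L] [Algebra.IsSeparable F L]
    {v : ℝ} (hv : 0 < v) {σ : L ≃ₐ[F] L} (hσ : σ ∈ upperRamificationGroup O F L v)
    {ℓ : ℕ} (hℓ : ℓ.Prime) (hunit : IsUnit (ℓ : O)) :
    ∃ m : ℕ, m.Coprime ℓ ∧ σ ^ m = 1 := by
  -- With `m` the prime-to-`ℓ` part of the order, `σ ^ m` is wild of order dividing `ℓ ^ a`, hence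
  -- trivial.
  obtain ⟨a, m, hm, ha⟩ := Nat.exists_eq_pow_mul_and_not_dvd (orderOf_pos σ).ne' ℓ hℓ.ne_one
  refine ⟨m, ((Nat.Prime.coprime_iff_not_dvd hℓ).2 hm).symm, ?_⟩
  refine eq_one_of_mem_lowerRamificationGroup O F L (herbrandPsi_pos O F L hv)
    (pow_mem hσ m) (m := ℓ ^ a) (by rw [Nat.cast_pow]; exact hunit.pow a) ?_
  rw [← pow_mul, mul_comm, ← ha, pow_orderOf_eq_one]

end LocalRamification

/-- On the Galois closure of `F(x)` some power `σ ^ m` with `m` prime to `ℓ` is trivial. Both `σ ^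
m` and `σ ^ (ℓ ^ n)` then fix `x`, and Bézout gives `σ`. -/
theorem eq_of_pow_eq_of_mem_absoluteUpperRamificationGroup {O F : Type*} [CommRing O] [Field F]
    [Algebra O F] [IsFractionRing O F] [IsDomain O] [IsIntegrallyClosed O] [IsNoetherianRing O]
    [CharZero F] {v : ℝ} (hv : 0 < v) {σ : AlgebraicClosure F ≃ₐ[F] AlgebraicClosure F}
    (hσ : σ ∈ absoluteUpperRamificationGroup O F v) {ℓ : ℕ} (hℓ : ℓ.Prime)
    (hunit : IsUnit (ℓ : O)) {n : ℕ} {x : AlgebraicClosure F} (hx : (σ ^ (ℓ ^ n)) x = x) :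
    σ x = x := by
  let L : FiniteGaloisIntermediateField F (AlgebraicClosure F) :=
    FiniteGaloisIntermediateField.adjoin F {x}
  have hxL : x ∈ L.toIntermediateField := FiniteGaloisIntermediateField.subset_adjoin F {x} rfl
  have hσL : AlgEquiv.restrictNormalHom L σ ∈ upperRamificationGroup O F L v :=
    Subgroup.mem_iInf.1 hσ L
  obtain ⟨m, hm, h1⟩ := exists_coprime_pow_eq_one_of_mem_upperRamificationGroup O F L hv hσL hℓ hunit
  have hmx : (σ ^ m) x = x := by
    have h2 := AlgEquiv.restrictNormal_commutes (σ ^ m) L ⟨x, hxL⟩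
    have h3 : (σ ^ m).restrictNormal L = 1 := by
      rw [← h1, ← map_pow]; rfl
    rw [h3] at h2
    exact h2.symm
  have hc : (ℓ ^ n).Coprime m := (Nat.Coprime.pow_right n hm).symm
  have e1 : (σ ^ (ℓ ^ n)) • x = x := hx
  have e2 : (σ ^ m) • x = x := hmx
  have hs : σ ^ Nat.gcd (ℓ ^ n) m ∈ MulAction.stabilizer (AlgebraicClosure F ≃ₐ[F] AlgebraicClosure F) x := by
    rw [← zpow_natCast, Nat.gcd_eq_gcd_ab, zpow_add, zpow_mul, zpow_mul]
    exact mul_mem (zpow_mem (MulAction.mem_stabilizer_iff.2 (by rwa [zpow_natCast])) _) (zpow_mem (MulAction.mem_stabilizer_iff.2 (by rwa [zpow_natCast])) _)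
  rw [hc, pow_one] at hs
  exact hs

theorem isUnit_natCast_adicCompletionIntegers {K : Type*} [Field K] [NumberField K]
    (π : HeightOneSpectrum (𝓞 K)) {ℓ : ℕ} (h : (ℓ : 𝓞 K) ∉ π.asIdeal) :
    IsUnit (ℓ : π.adicCompletionIntegers K) := by
  rw [HeightOneSpectrum.adicCompletionIntegers.isUnit_iff_valued_eq_one]
  have h1 := (π.valuation_eq_one_iff_notMem (K := K)).2 h
  have h2 := π.valuedAdicCompletion_eq_valuation (K := K) (ℓ : 𝓞 K)
  rw [h1] at h2
  change Valued.v (algebraMap (𝓞 K) (π.adicCompletion K) ℓ) = 1 at h2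
  rw [map_natCast] at h2
  exact h2

instance adicCompletion_charZero {K : Type*} [Field K] [NumberField K]
    (π : HeightOneSpectrum (𝓞 K)) : CharZero (π.adicCompletion K) :=
  charZero_of_injective_algebraMap (algebraMap K (π.adicCompletion K)).injective

/-! ### Points of finite group schemes in characteristic zero -/

section Cartier

open TensorProduct TrivSqZeroExt

/-- The map on dual numbers induced by an algebra homomorphism. -/
def dualMap {R B C : Type*} [CommRing R] [CommRing B] [CommRing C] [Algebra R B] [Algebra R C]
    (f : B →ₐ[R] C) : TrivSqZeroExt B B →ₐ[R] TrivSqZeroExt C C where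
  toFun x := inl (f x.fst) + inr (f x.snd)
  map_one' := by ext <;> simp
  map_mul' x y := by ext <;> simp
  map_zero' := by ext <;> simp
  map_add' x y := by ext <;> simp
  commutes' r := by ext <;> simp [TrivSqZeroExt.algebraMap_eq_inl']

@[simp]
theorem fst_dualMap {R B C : Type*} [CommRing R] [CommRing B] [CommRing C] [Algebra R B]
    [Algebra R C] (f : B →ₐ[R] C) (x : TrivSqZeroExt B B) : (dualMap f x).fst = f x.fst := by
  simp [dualMap]

@[simp]
theorem snd_dualMap {R B C : Type*} [CommRing R] [CommRing B] [CommRing C] [Algebra R B]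
    [Algebra R C] (f : B →ₐ[R] C) (x : TrivSqZeroExt B B) : (dualMap f x).snd = f x.snd := by
  simp [dualMap]

variable {k A : Type*} [Field k] [CommRing A] [Algebra k A]

/-- The `k[ε]`-point above a `k`-point `φ` given by a tangent vector `d` at `φ`. -/
def tangentAlgHom (φ : A →ₐ[k] k) (d : A →ₗ[k] k) (hd1 : d 1 = 0)
    (hd : ∀ a b, φ a = 0 → φ b = 0 → d (a * b) = 0) : A →ₐ[k] TrivSqZeroExt k k :=
  AlgHom.ofLinearMap
    { toFun := fun a => inl (φ a) + inr (d a)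
      map_add' := fun a b => by ext <;> simp
      map_smul' := fun c a => by ext <;> simp }
    (by ext <;> simp [hd1]) (fun a b => by
      have h := hd (a - algebraMap k A (φ a)) (b - algebraMap k A (φ b)) (by simp) (by simp)
      have e : (a - algebraMap k A (φ a)) * (b - algebraMap k A (φ b)) =
          a * b - φ a • b - φ b • a + (φ a * φ b) • 1 := by
        simp only [Algebra.smul_def, map_mul]; ring
      rw [e] at h
      simp only [map_add, map_sub, map_smul, hd1, smul_eq_mul, mul_zero, add_zero] at h
      ext
      · simp
      · simp
        linear_combination h)

/-- A function vanishing at a point of an Artinian scheme is nilpotent near it. The powers of `x`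
stabilise, `x ^ n = x ^ (n + 1) * y`, and `1 - x * y` is the cutoff equal to `1` at the point. -/
theorem exists_mul_pow_eq_zero [IsArtinianRing A] (φ : A →ₐ[k] k) {x : A} (hx : φ x = 0) :
    ∃ (n : ℕ) (g : A), φ g = 1 ∧ g * x ^ n = 0 := by
  obtain ⟨n, y, hy⟩ := IsArtinian.exists_pow_succ_smul_dvd (M := A) x (1 : A)
  refine ⟨n, 1 - x * y, by simp [hx], ?_⟩
  simp only [Nat.succ_eq_add_one, smul_eq_mul, mul_one] at hy
  linear_combination -hy

/-- Differentiating `g * x ^ (n + 1) = 0` lowers the exponent of `x`; characteristic zero keeps the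
factor `n + 1` invertible. At exponent `0` the cutoff `g` would vanish. -/
theorem not_derivation_eq_one [CharZero k] [IsArtinianRing A] (φ : A →ₐ[k] k)
    (D : Derivation k A A) {x : A} (hx : φ x = 0) (hDx : φ (D x) = 1) : False := by
  obtain ⟨n, hn⟩ := exists_mul_pow_eq_zero φ hx
  induction n with
  | zero =>
    obtain ⟨g, hg, h0⟩ := hn
    rw [pow_zero, mul_one] at h0
    rw [h0, map_zero] at hg
    exact zero_ne_one hg
  | succ n ih =>
    obtain ⟨g, hg, h0⟩ := hn
    have h1 : D (g * x ^ (n + 1)) = 0 := by rw [h0, map_zero]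
    rw [D.leibniz, D.leibniz_pow] at h1
    have hne : ((n + 1 : ℕ) : k) ≠ 0 := Nat.cast_ne_zero.2 (Nat.succ_ne_zero n)
    -- The extra factor `g` kills the term `D g * x ^ (n + 1)`; the scalar restores the value `1` at
    -- `φ`.
    refine ih ⟨algebraMap k A ((n + 1 : ℕ) : k)⁻¹ * ((n + 1 : ℕ) * g ^ 2 * D x), ?_, ?_⟩
    · simp only [map_mul, map_pow, hg, hDx, map_natCast, AlgHom.commutes]
      simp [inv_mul_cancel₀ (Nat.cast_add_one_ne_zero n : (n : k) + 1 ≠ 0)]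
    · have : (n + 1 : ℕ) * g ^ 2 * D x * x ^ n = 0 := by
        have := congrArg (g * ·) h1
        simp only [smul_eq_mul, nsmul_eq_mul, Nat.add_sub_cancel, mul_zero] at this
        linear_combination this - D g * h0
      rw [mul_assoc, this, mul_zero]

/-- Points of a finite reduced scheme over an algebraically closed field. -/
theorem card_algHom_eq_finrank_of_forall_eq_zero [IsAlgClosed k] [Module.Finite k A]
    (h : ∀ x : A, (∀ φ : A →ₐ[k] k, φ x = 0) → x = 0) :
    Nat.card (A →ₐ[k] k) = Module.finrank k A ∧ Finite (A →ₐ[k] k) := by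
  have hli := linearIndependent_algHom_toLinearMap k A k
  have hfin : Finite (A →ₐ[k] k) := hli.finite
  have := Fintype.ofFinite (A →ₐ[k] k)
  refine ⟨le_antisymm ?_ ?_, hfin⟩
  -- Independence of characters bounds the points from above; injectivity of evaluation at all
  -- points bounds them from below.
  · rw [Nat.card_eq_fintype_card]
    simpa [Subspace.dual_finrank_eq] using hli.fintype_card_le_finrank
  · let e : A →ₗ[k] ((A →ₐ[k] k) → k) := LinearMap.pi fun φ => φ.toLinearMap
    have he : Function.Injective e := (injective_iff_map_eq_zero e).2 fun x hx =>
      h x fun φ => congrFun hx φ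
    simpa [Nat.card_eq_fintype_card] using LinearMap.finrank_le_finrank_of_injective he

theorem exists_algHom_ker_eq [IsAlgClosed k] [Module.Finite k A] (m : Ideal A) [m.IsMaximal] :
    ∃ φ : A →ₐ[k] k, RingHom.ker φ = m := by
  let _ : Field (A ⧸ m) := Ideal.Quotient.field m
  have hb : Function.Bijective (algebraMap k (A ⧸ m)) :=
    IsAlgClosed.algebraMap_bijective_of_isIntegral
  let e : k ≃ₐ[k] (A ⧸ m) := AlgEquiv.ofBijective (Algebra.ofId k (A ⧸ m)) hb
  refine ⟨e.symm.toAlgHom.comp (Ideal.Quotient.mkₐ k m), ?_⟩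
  ext x
  simp [RingHom.mem_ker, Ideal.Quotient.eq_zero_iff_mem]

/-- If every tangent vector of a finite scheme over an algebraically closed field of
characteristic zero extends to a vector field, then the scheme is reduced. -/
theorem eq_zero_of_forall_exists_derivation [IsAlgClosed k] [CharZero k] [Module.Finite k A]
    (H : ∀ (φ : A →ₐ[k] k) (q : A →ₐ[k] TrivSqZeroExt k k), (∀ a, (q a).fst = φ a) →
      ∃ D : Derivation k A A, ∀ a, φ (D a) = (q a).snd)
    (x : A) (hx : ∀ φ : A →ₐ[k] k, φ x = 0) : x = 0 := by
  have : IsArtinianRing A := IsArtinianRing.of_finite k A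
  -- If `𝔪 ≠ 𝔪²` at `φ`, a functional killing `𝔪²` and `1` but not `y` is a tangent vector; no
  -- derivation can extend it.
  have idem : ∀ φ : A →ₐ[k] k, RingHom.ker φ ≤ RingHom.ker φ • RingHom.ker φ := by
    intro φ y hy
    by_contra hy2
    let W : Submodule k A := ((RingHom.ker φ • RingHom.ker φ : Ideal A).restrictScalars k) ⊔
      Submodule.span k {1}
    have hyW : y ∉ W := by
      intro hyW
      obtain ⟨z, hz, w, hw, hzw⟩ := Submodule.mem_sup.1 hyW
      obtain ⟨c, rfl⟩ := Submodule.mem_span_singleton.1 hw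
      have hz' : φ z = 0 := (Ideal.mul_le_left hz : z ∈ RingHom.ker φ)
      have := congrArg φ hzw
      rw [map_add, hz', map_smul, map_one, (show φ y = 0 from hy), zero_add, smul_eq_mul,
        mul_one] at this
      rw [this, zero_smul, add_zero] at hzw
      exact hy2 (hzw ▸ hz)
    obtain ⟨d, hd, hdW⟩ := Submodule.exists_le_ker_of_notMem hyW
    have hd1 : d 1 = 0 := hdW (Submodule.mem_sup_right (Submodule.mem_span_singleton_self 1))
    obtain ⟨D, hD⟩ := H φ (tangentAlgHom φ d hd1 fun a b ha hb =>
      hdW (Submodule.mem_sup_left (Ideal.mul_mem_mul ha hb))) fun a => by simp [tangentAlgHom]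
    refine not_derivation_eq_one φ D (x := (d y)⁻¹ • y) ?_ ?_
    · rw [map_smul, (show φ y = 0 from hy), smul_zero]
    · rw [hD]
      simp [tangentAlgHom, inv_mul_cancel₀ hd]
  have hann : Ideal.span {x} = ⊥ := by
    by_contra hne
    obtain ⟨m, hm, hle⟩ := Ideal.exists_le_maximal (Submodule.annihilator (Ideal.span {x}))
      (by rwa [Ne, Submodule.annihilator_eq_top_iff])
    obtain ⟨φ, rfl⟩ := exists_algHom_ker_eq (k := k) m
    -- Nakayama: `r ≡ 1` modulo `𝔪` kills `𝔪`, hence `x`, so `r` lies in the annihilator, which is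
    -- contained in `𝔪`.
    obtain ⟨r, hr1, hr2⟩ := Submodule.exists_sub_one_mem_and_smul_eq_zero_of_fg_of_le_smul
      (RingHom.ker φ) (RingHom.ker φ) (IsNoetherian.noetherian _) (idem φ)
    have hr : r ∈ Submodule.annihilator (Ideal.span {x}) := by
      rw [Submodule.mem_annihilator_span_singleton]
      exact hr2 x (hx φ)
    have h1 : (1 : A) ∈ RingHom.ker φ := by
      have := sub_mem (hle hr) hr1
      rwa [sub_sub_cancel] at this
    exact hm.ne_top ((Ideal.eq_top_iff_one _).2 h1)
  exact Ideal.span_singleton_eq_bot.1 hann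

variable {R A₀ : Type u} {k : Type u} [Field k] [CommRing R] [CommRing A₀] [Algebra R A₀]
  [Algebra R k]

/-- **Cartier's theorem** for finite group schemes, in terms of points: the order of a finite
group scheme is the number of its points in an algebraically closed field of characteristic zero. -/
theorem card_algHom_eq_finrank [IsAlgClosed k] [CharZero k] [Module.Finite R A₀]
    [∀ (B : Type u) [CommRing B] [Algebra R B], Group (A₀ →ₐ[R] B)]
    (hcomp : ∀ (B C : Type u) [CommRing B] [CommRing C] [Algebra R B] [Algebra R C]
      (f : B →ₐ[R] C) (x y : A₀ →ₐ[R] B), f.comp (x * y) = f.comp x * f.comp y) :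
    Nat.card (A₀ →ₐ[R] k) = Module.finrank k (k ⊗[R] A₀) ∧ Finite (A₀ →ₐ[R] k) := by
  have hone : ∀ (B C : Type u) [CommRing B] [CommRing C] [Algebra R B] [Algebra R C]
      (f : B →ₐ[R] C), f.comp (1 : A₀ →ₐ[R] B) = 1 := fun B C _ _ _ _ f => by
    have := hcomp B C f 1 1
    rwa [mul_one, left_eq_mul] at this
  have hdiv : ∀ (B C : Type u) [CommRing B] [CommRing C] [Algebra R B] [Algebra R C]
      (f : B →ₐ[R] C) (x y : A₀ →ₐ[R] B), f.comp (x⁻¹ * y) = (f.comp x)⁻¹ * f.comp y :=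
    fun B C _ _ _ _ f x y => by
      rw [eq_inv_mul_iff_mul_eq, ← hcomp, mul_inv_cancel_left]
  let A := k ⊗[R] A₀
  let inc : A₀ →ₐ[R] A := Algebra.TensorProduct.includeRight
  let E : (A₀ →ₐ[R] k) ≃ (A →ₐ[k] k) := AlgHom.liftEquiv R k A₀ k
  suffices H : ∀ (φ : A →ₐ[k] k) (q : A →ₐ[k] TrivSqZeroExt k k), (∀ a, (q a).fst = φ a) →
      ∃ D : Derivation k A A, ∀ a, φ (D a) = (q a).snd by
    obtain ⟨h1, h2⟩ := card_algHom_eq_finrank_of_forall_eq_zero (k := k) (A := A)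
      (eq_zero_of_forall_exists_derivation (k := k) (A := A) H)
    exact ⟨(Nat.card_congr E).trans h1, Finite.of_equiv _ E.symm⟩
  intro φ q hq
  let φ' : A →ₐ[R] k := φ.restrictScalars R
  let φ₀ : A₀ →ₐ[R] k := φ'.comp inc
  let q₀ : A₀ →ₐ[R] TrivSqZeroExt k k := (q.restrictScalars R).comp inc
  let j : TrivSqZeroExt k k →ₐ[R] TrivSqZeroExt A A := dualMap ((Algebra.ofId k A).restrictScalars R)
  -- Translate the tangent vector `q₀` to the identity, then multiply the universal point `inc` by
  -- it: `w` is an invariant vector field with value `q₀` at `φ₀`.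
  let t : A₀ →ₐ[R] TrivSqZeroExt k k := ((inlAlgHom R k k).comp φ₀)⁻¹ * q₀
  let w : A₀ →ₐ[R] TrivSqZeroExt A A := ((inlAlgHom R A A).comp inc) * j.comp t
  have hfstq : (fstHom R k k).comp q₀ = φ₀ := by
    ext a; exact hq (inc a)
  have hfstt : (fstHom R k k).comp t = 1 := by
    rw [hdiv, hfstq, ← AlgHom.comp_assoc]
    have : (fstHom R k k).comp (inlAlgHom R k k) = AlgHom.id R k := AlgHom.ext fun _ => rfl
    rw [this, AlgHom.id_comp, inv_mul_cancel]
  have hfstw : (fstHom R A A).comp w = inc := by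
    rw [hcomp, ← AlgHom.comp_assoc, ← AlgHom.comp_assoc]
    have e1 : (fstHom R A A).comp (inlAlgHom R A A) = AlgHom.id R A := AlgHom.ext fun _ => rfl
    have e2 : (fstHom R A A).comp j =
        ((Algebra.ofId k A).restrictScalars R).comp (fstHom R k k) :=
      AlgHom.ext fun x => fst_dualMap ((Algebra.ofId k A).restrictScalars R) x
    rw [e1, e2, AlgHom.comp_assoc, hfstt, hone, mul_one, AlgHom.id_comp]
  have hφw : (dualMap φ').comp w = q₀ := by
    rw [hcomp, ← AlgHom.comp_assoc, ← AlgHom.comp_assoc]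
    have e1 : (dualMap φ').comp (inlAlgHom R A A) = (inlAlgHom R k k).comp φ' :=
      AlgHom.ext fun x => TrivSqZeroExt.ext (fst_dualMap φ' _)
        ((snd_dualMap φ' _).trans (map_zero φ'))
    have e2 : (dualMap φ').comp j = AlgHom.id R _ :=
      AlgHom.ext fun x => TrivSqZeroExt.ext
        ((fst_dualMap φ' _).trans ((congrArg φ' (fst_dualMap _ x)).trans (φ.commutes _)))
        ((snd_dualMap φ' _).trans ((congrArg φ' (snd_dualMap _ x)).trans (φ.commutes _)))
    rw [e1, e2, AlgHom.comp_assoc, AlgHom.id_comp, mul_inv_cancel_left]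
  let W : A →ₐ[k] TrivSqZeroExt A A := AlgHom.liftEquiv R k A₀ _ w
  have hW : ∀ a, W (inc a) = w a := fun a =>
    DFunLike.congr_fun ((AlgHom.liftEquiv R k A₀ (TrivSqZeroExt A A)).symm_apply_apply w) a
  have hWfst : ∀ a, (W a).fst = a := by
    have : (fstHom k A A).comp W = AlgHom.id k A := by
      apply Algebra.TensorProduct.ext_ring
      ext a : 1
      exact (congrArg fst (hW a)).trans (DFunLike.congr_fun hfstw a)
    exact fun a => DFunLike.congr_fun this a
  have hWq : ∀ a, dualMap φ (W a) = q a := by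
    have : (dualMap φ).comp W = q := by
      apply Algebra.TensorProduct.ext_ring
      ext a : 1
      exact (congrArg (dualMap φ) (hW a)).trans (DFunLike.congr_fun hφw a)
    exact fun a => DFunLike.congr_fun this a
  -- An algebra map `a ↦ a + ε D(a)` is the same as a derivation `D`.
  refine ⟨Derivation.mk' ((sndHom A A).restrictScalars k ∘ₗ W.toLinearMap) ?_, fun a => ?_⟩
  · intro a b
    simp [hWfst, mul_comm]
  · rw [← hWq]; simp

end Cartier

/-! ### Descent of finiteness along faithfully flat morphisms -/

section Descent

open Limits

variable {X Y Z P : Scheme.{u}}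

theorem isSeparated_of_universallyClosed_diagonal (f : X ⟶ Y)
    [UniversallyClosed (pullback.diagonal f)] : IsSeparated f :=
  ⟨.of_isPreimmersion _ (pullback.diagonal f).isClosedMap.isClosed_range⟩

theorem universallyClosed_diagonal_of_isPullback {fst : P ⟶ X} {snd : P ⟶ Y} {f : X ⟶ Z} {g : Y ⟶ Z}
    (h : IsPullback fst snd f g)
    (hf : (@Surjective ⊓ @Flat ⊓ @QuasiCompact : MorphismProperty Scheme.{u}) f)
    [UniversallyClosed (pullback.diagonal fst)] : UniversallyClosed (pullback.diagonal g) := by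
  let W : MorphismProperty Scheme.{u} := @UniversallyClosed
  let V : MorphismProperty Scheme.{u} := @Surjective ⊓ @Flat ⊓ @QuasiCompact
  have h1 : W.DescendsAlong V :=
    descendsAlong_universallyClosed_surjective_inf_flat_inf_quasicompact
  have h2 : W.RespectsIso := universallyClosed_respectsIso
  have h3 : V.IsStableUnderBaseChange :=
    have : (@Surjective ⊓ @Flat : MorphismProperty Scheme.{u}).IsStableUnderBaseChange :=
      MorphismProperty.IsStableUnderBaseChange.inf
    MorphismProperty.IsStableUnderBaseChange.inf
  exact MorphismProperty.of_isPullback_of_descendsAlong (P := W.diagonal) (Q := V) h hf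
    (show UniversallyClosed (pullback.diagonal fst) from inferInstance)

/-- Finite means proper and locally quasi-finite. Universal closedness, finite type and
separatedness (through the diagonal) descend, and each fibre of `g` is covered by a fibre of `fst`.
-/
theorem isFinite_of_isPullback {fst : P ⟶ X} {snd : P ⟶ Y} {f : X ⟶ Z} {g : Y ⟶ Z}
    (h : IsPullback fst snd f g) [Surjective f] [Flat f] [QuasiCompact f] [IsFinite fst] :
    IsFinite g := by
  have hf : (@Surjective ⊓ @Flat ⊓ @QuasiCompact : MorphismProperty Scheme.{u}) f :=
    ⟨⟨inferInstance, inferInstance⟩, inferInstance⟩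
  have huc : UniversallyClosed g :=
    MorphismProperty.of_isPullback_of_descendsAlong (P := @UniversallyClosed) h hf inferInstance
  have hft : LocallyOfFiniteType g :=
    MorphismProperty.of_isPullback_of_descendsAlong (P := @LocallyOfFiniteType) h hf inferInstance
  have hdiag : UniversallyClosed (pullback.diagonal g) :=
    universallyClosed_diagonal_of_isPullback h hf
  have hsep : IsSeparated g := isSeparated_of_universallyClosed_diagonal g
  have hqf : LocallyQuasiFinite g := by
    refine LocallyQuasiFinite.of_finite_preimage_singleton _ fun z => ?_
    obtain ⟨x, rfl⟩ := f.surjective z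
    refine ((fst.finite_preimage_singleton x).image snd).subset fun y hy => ?_
    obtain ⟨p, hp1, hp2⟩ := Scheme.Pullback.exists_preimage_pullback x y hy.symm
    refine ⟨h.isoPullback.inv p, ?_, ?_⟩
    · rw [Set.mem_preimage, ← Scheme.Hom.comp_apply, h.isoPullback_inv_fst]; exact hp1
    · rw [← Scheme.Hom.comp_apply, h.isoPullback_inv_snd]; exact hp2
  have : IsProper g := {}
  exact IsFinite.of_isProper_of_locallyQuasiFinite g

theorem stalkMap_faithfullyFlat (f : X ⟶ Y) [Flat f] (x : X) :
    (f.stalkMap x).hom.FaithfullyFlat := by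
  algebraize [(f.stalkMap x).hom]
  exact @Module.FaithfullyFlat.of_flat_of_isLocalHom _ _ _ _ _ _ _
      (Flat.stalkMap f x) (f.toLRSHom.prop x)

theorem app_injective_of_flat_of_surjective (f : X ⟶ Y) [Flat f] [Surjective f] (V : Y.Opens) :
    Function.Injective (f.app V) := by
  rw [injective_iff_map_eq_zero]
  intro s hs
  refine TopCat.Presheaf.section_ext Y.sheaf V s 0 fun y hy => ?_
  obtain ⟨x, rfl⟩ := f.surjective y
  apply (stalkMap_faithfullyFlat f x).injective
  have h := Scheme.Hom.germ_stalkMap_apply f V x hy s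
  rw [hs, map_zero] at h
  refine h.trans ?_
  erw [map_zero, map_zero]

/-- `C ⊗_B (B ⊗_A N) = C ⊗_A N`, and injectivity can be tested after `C ⊗_B -`. -/
theorem flat_of_flat_of_faithfullyFlat (A B C : Type*) [CommRing A] [CommRing B] [CommRing C]
    [Algebra A B] [Algebra B C] [Algebra A C] [IsScalarTower A B C] [Module.Flat A C]
    [Module.FaithfullyFlat B C] : Module.Flat A B := by
  rw [Module.Flat.iff_lTensor_preserves_injective_linearMap]
  intro N N' _ _ _ _ f hf
  have h : Function.Injective ((TensorProduct.AlgebraTensorModule.lTensor B B f).lTensor C) := by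
    have hC := Module.Flat.lTensor_preserves_injective_linearMap (M := C) f hf
    have e := TensorProduct.AlgebraTensorModule.lTensor_comp_cancelBaseChange A B B (M := C) f
    have e' : ⇑(TensorProduct.AlgebraTensorModule.cancelBaseChange A B B C N') ∘
        ⇑((TensorProduct.AlgebraTensorModule.lTensor B B f).lTensor C) =
        ⇑(f.lTensor C) ∘ ⇑(TensorProduct.AlgebraTensorModule.cancelBaseChange A B B C N) :=
      (congrArg DFunLike.coe e).symm
    refine Function.Injective.of_comp (f := TensorProduct.AlgebraTensorModule.cancelBaseChange
      A B B C N') ?_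
    rw [e']
    exact hC.comp (LinearEquiv.injective _)
  exact (Module.FaithfullyFlat.lTensor_injective_iff_injective B C _).1 h

theorem flat_of_flat_comp_of_surjective (f : X ⟶ Y) (g : Y ⟶ Z) [Flat f] [Surjective f]
    [Flat (f ≫ g)] : Flat g := by
  refine Flat.of_stalkMap _ fun y => ?_
  obtain ⟨x, rfl⟩ := f.surjective y
  have h1 := stalkMap_faithfullyFlat f x
  have h2 := Flat.stalkMap (f ≫ g) x
  rw [Scheme.Hom.stalkMap_comp] at h2
  algebraize [(f.stalkMap x).hom, (g.stalkMap (f x)).hom,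
    ((f.stalkMap x).hom.comp (g.stalkMap (f x)).hom)]
  have h3 : Module.Flat (Z.presheaf.stalk (g (f x))) (X.presheaf.stalk x) := h2
  exact flat_of_flat_of_faithfullyFlat _ (Y.presheaf.stalk (f x)) (X.presheaf.stalk x)

/-- The Artin–Tate lemma; faithful flatness supplies the inclusion of the rings of sections. -/
theorem locallyOfFiniteType_of_comp_of_isFinite [IsLocallyNoetherian Z] (f : X ⟶ Y) (g : Y ⟶ Z)
    [Flat f] [Surjective f] [IsFinite f] [LocallyOfFiniteType (f ≫ g)] :
    LocallyOfFiniteType g := by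
  refine ⟨fun {U} hU {V} hV e => ?_⟩
  have hW : IsAffineOpen (f ⁻¹ᵁ V) := hV.preimage f
  have h1 : ((f ≫ g).appLE U (f ⁻¹ᵁ V) (fun x hx => e hx)).hom.FiniteType :=
    (f ≫ g).finiteType_appLE hU hW _
  have h2 : (f.app V).hom.Finite := f.finite_app V hV
  have h3 := app_injective_of_flat_of_surjective f V
  have hc : (f ≫ g).appLE U (f ⁻¹ᵁ V) (fun x hx => e hx) = g.appLE U V e ≫ f.app V := by
    simp [Scheme.Hom.appLE]
  rw [hc, CommRingCat.hom_comp] at h1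
  have hN : IsNoetherianRing Γ(Z, U) := IsLocallyNoetherian.component_noetherian ⟨U, hU⟩
  algebraize [(g.appLE U V e).hom, (f.app V).hom, ((f.app V).hom.comp (g.appLE U V e).hom)]
  exact ⟨fg_of_fg_of_fg Γ(Z, U) Γ(Y, V) Γ(X, f ⁻¹ᵁ V) Algebra.FiniteType.out Module.Finite.fg_top h3⟩

/-- The target of a finite faithfully flat morphism from a finite scheme is finite. -/
theorem isFinite_of_isFinite_comp [IsLocallyNoetherian Z] (f : X ⟶ Y) (g : Y ⟶ Z)
    [Flat f] [Surjective f] [IsFinite f] [IsFinite (f ≫ g)] : IsFinite g := by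
  have hft := locallyOfFiniteType_of_comp_of_isFinite f g
  have huc : UniversallyClosed g := .of_comp_surjective f g
  have hsep : IsSeparated g := by
    -- This composite is the diagonal of `f ≫ g` followed by `f × f`; surjectivity of `f` then
    -- cancels it.
    have : UniversallyClosed (f ≫ pullback.diagonal g) := by
      have hmap : UniversallyClosed (pullback.map (f ≫ g) (f ≫ g) g g f f (𝟙 Z)
          ((Category.comp_id _).trans rfl) ((Category.comp_id _).trans rfl)) :=
        MorphismProperty.pullbackMap (P := @UniversallyClosed) (inferInstance) (inferInstance)
          rfl rfl
      have e : f ≫ pullback.diagonal g = pullback.diagonal (f ≫ g) ≫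
          pullback.map (f ≫ g) (f ≫ g) g g f f (𝟙 Z)
          ((Category.comp_id _).trans rfl) ((Category.comp_id _).trans rfl) := by
        apply pullback.hom_ext
        · rw [Category.assoc, Category.assoc, pullback.diagonal_fst, pullback.map, pullback.lift_fst,
            pullback.diagonal_fst_assoc, Category.comp_id]
        · rw [Category.assoc, Category.assoc, pullback.diagonal_snd, pullback.map, pullback.lift_snd,
            pullback.diagonal_snd_assoc, Category.comp_id]
      rw [e]
      infer_instance
    have : UniversallyClosed (pullback.diagonal g) := .of_comp_surjective f _
    exact isSeparated_of_universallyClosed_diagonal g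
  have hqf : LocallyQuasiFinite g := by
    refine LocallyQuasiFinite.of_finite_preimage_singleton _ fun z => ?_
    refine (((f ≫ g).finite_preimage_singleton z).image f).subset fun y hy => ?_
    obtain ⟨x, rfl⟩ := f.surjective y
    exact ⟨x, by simpa using hy, rfl⟩
  have : IsProper g := {}
  exact IsFinite.of_isProper_of_locallyQuasiFinite g

end Descent

/-! ### The ring of `π`-integers is Noetherian -/

section PiInteger

variable {K : Type*} [Field K] [NumberField K] (π : HeightOneSpectrum (𝓞 K))

/-- Finiteness of the class group. -/
theorem exists_span_singleton_eq_pow : ∃ (a : 𝓞 K) (h : ℕ), 0 < h ∧ Ideal.span {a} = π.asIdeal ^ h := by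
  have h1 : ClassGroup.mk0 (⟨π.asIdeal, mem_nonZeroDivisors_of_ne_zero π.ne_bot⟩ :
      nonZeroDivisors (Ideal (𝓞 K))) ^ Fintype.card (ClassGroup (𝓞 K)) = 1 := pow_card_eq_one
  rw [← map_pow, ClassGroup.mk0_eq_one_iff] at h1
  obtain ⟨a, ha⟩ := h1.principal
  exact ⟨a, _, Fintype.card_pos, ha.symm⟩

theorem exists_isLocalizationAway_piInteger :
    ∃ a : 𝓞 K, IsLocalization.Away a (PiInteger π) := by
  obtain ⟨a, h, hpos, ha⟩ := exists_span_singleton_eq_pow π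
  have ha0 : a ≠ 0 := by
    rintro rfl
    rw [Ideal.span_singleton_eq_bot.2 rfl] at ha
    exact pow_ne_zero h π.ne_bot ha.symm
  have haK : algebraMap (𝓞 K) K a ≠ 0 := by
    rwa [Ne, FaithfulSMul.algebraMap_eq_zero_iff]
  have haπ : a ∈ π.asIdeal := by
    have : a ∈ π.asIdeal ^ h := ha ▸ Ideal.mem_span_singleton_self a
    exact Ideal.pow_le_self hpos.ne' this
  have hav : ∀ v : HeightOneSpectrum (𝓞 K), v ≠ π → v.valuation K (algebraMap (𝓞 K) K a) = 1 := by
    intro v hv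
    rw [v.valuation_eq_one_iff_notMem]
    intro hmem
    have h1 : π.asIdeal ^ h ≤ v.asIdeal := by
      rw [← ha, Ideal.span_singleton_le_iff_mem]; exact hmem
    have h2 : π.asIdeal ≤ v.asIdeal := v.isPrime.le_of_pow_le h1
    exact hv (HeightOneSpectrum.ext (π.isMaximal.eq_of_le v.isPrime.ne_top h2).symm)
  refine ⟨a, IsLocalization.Away.mk a ?_ ?_ ?_⟩
  · rw [isUnit_iff_exists_inv]
    refine ⟨⟨(algebraMap (𝓞 K) K a)⁻¹, fun v hv => ?_⟩, ?_⟩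
    · rw [map_inv₀, hav v hv, inv_one]
    · exact Subtype.ext (mul_inv_cancel₀ haK)
  · intro x
    have hlt : π.valuation K (algebraMap (𝓞 K) K a) < 1 := (π.valuation_lt_one_iff_mem a).2 haπ
    have hne : π.valuation K (algebraMap (𝓞 K) K a) ≠ 0 := by simpa using ha0
    -- A large power of `a` clears the pole of `x` at `π`; elsewhere `a` is a unit.
    obtain ⟨n, hn⟩ := MulArchimedean.arch (π.valuation K (x : K))
      ((one_lt_inv₀ (zero_lt_iff.2 hne)).2 hlt)
    obtain ⟨b, hb⟩ := HeightOneSpectrum.mem_integers_of_valuation_le_one K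
      ((x : K) * algebraMap (𝓞 K) K a ^ n) (fun v => by
        rw [map_mul, map_pow]
        by_cases hv : v = π
        · rw [hv]
          calc _ ≤ (π.valuation K (algebraMap (𝓞 K) K a))⁻¹ ^ n *
                π.valuation K (algebraMap (𝓞 K) K a) ^ n := by gcongr
            _ = 1 := by rw [← mul_pow, inv_mul_cancel₀ hne, one_pow]
        · rw [hav v hv, one_pow, mul_one]
          exact x.2 v hv)
    exact ⟨n, b, Subtype.ext hb.symm⟩
  · intro b c hbc
    refine ⟨0, ?_⟩
    have : algebraMap (𝓞 K) K b = algebraMap (𝓞 K) K c := congrArg (Subtype.val : PiInteger π → K) hbc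
    rw [FaithfulSMul.algebraMap_injective (𝓞 K) K this]

instance isNoetherianRing_piInteger : IsNoetherianRing (PiInteger π) := by
  obtain ⟨a, ha⟩ := exists_isLocalizationAway_piInteger π
  exact IsLocalization.isNoetherianRing (Submonoid.powers a) _ inferInstance

end PiInteger

/-! ### Short exact sequences of commutative group objects -/

section GroupObjects

variable {C : Type*} [Category* C] [CartesianMonoidalCategory C] [BraidedCategory C]

/-- The action `N × J → J` of the kernel `N` of `g : J → Q` makes `J` a torsor over `Q`. -/
theorem isPullback_fst_of_isKernel {N J Q : CommGrp C} {f : N ⟶ J} {g : J ⟶ Q}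
    (h : IsPullback f.hom.hom.hom (toUnit N.X) g.hom.hom.hom η[Q.X]) :
    IsPullback (fst J.X N.X) (fst J.X N.X * snd J.X N.X ≫ f.hom.hom.hom)
      g.hom.hom.hom g.hom.hom.hom := by
  have hfg : f.hom.hom.hom ≫ g.hom.hom.hom = 1 := h.w
  have hinj : ∀ {T : C} (a b : T ⟶ N.X), a ≫ f.hom.hom.hom = b ≫ f.hom.hom.hom → a = b :=
    fun a b hab => h.hom_ext hab (toUnit_unique _ _)
  refine ⟨⟨?_⟩, ⟨Limits.PullbackCone.IsLimit.mk _ (fun s => lift s.fst (h.lift (s.fst⁻¹ * s.snd)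
    (toUnit _) ?_)) (fun s => by simp) (fun s => ?_) fun s m h1 h2 => ?_⟩⟩
  · rw [MonObj.mul_comp, Category.assoc, hfg, MonObj.comp_one, mul_one]
  · rw [MonObj.mul_comp, GrpObj.inv_comp, s.condition, inv_mul_cancel]
    rfl
  · rw [MonObj.comp_mul, lift_fst, lift_snd_assoc, h.lift_fst, mul_inv_cancel_left]
  · rw [MonObj.comp_mul, h1] at h2
    apply CartesianMonoidalCategory.hom_ext
    · rw [h1, lift_fst]
    · rw [lift_snd]
      apply hinj
      rw [h.lift_fst, ← h2, inv_mul_cancel_left, Category.assoc]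

end GroupObjects

section Points

variable {K : Type u} [Field K] [NumberField K] {π : HeightOneSpectrum (𝓞 K)}

/-- The homomorphism on geometric points induced by a homomorphism of group schemes. -/
noncomputable def pointsMap {G H : CommGroupScheme π} (f : G ⟶ H) :
    (geometricPoint π ⟶ G.X) →* (geometricPoint π ⟶ H.X) where
  toFun P := P ≫ f.hom.hom.hom
  map_one' := MonObj.one_comp _
  map_mul' _ _ := MonObj.mul_comp _ _ _

theorem pointsMap_galoisRep {G H : CommGroupScheme π} (f : G ⟶ H)
    (σ : AlgebraicClosure K ≃ₐ[K] AlgebraicClosure K) (P : geometricPoint π ⟶ G.X) :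
    pointsMap f (galoisRep G σ P) = galoisRep H σ (pointsMap f P) :=
  Category.assoc (geometricPointMap π σ) P f.hom.hom.hom

end Points

/-! ### Points of affine group schemes -/

section AffinePoints

open TensorProduct

variable {R : Type u} [CommRing R]

/-- The spectrum of an `R`-algebra as a scheme over `Spec R`. -/
noncomputable def specOver (R : Type u) [CommRing R] (A : Type u) [CommRing A] [Algebra R A] :
    Over (Spec (CommRingCat.of R)) :=
  Over.mk (Spec.map (CommRingCat.ofHom (algebraMap R A)))

/-- The morphism of spectra over `Spec R` given by an `R`-algebra homomorphism. -/
noncomputable def specOverMap {A B : Type u} [CommRing A] [Algebra R A] [CommRing B] [Algebra R B]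
    (f : A →ₐ[R] B) : specOver R B ⟶ specOver R A :=
  Over.homMk (Spec.map (CommRingCat.ofHom (f : A →+* B))) (by
    simp only [specOver, Over.mk_hom, Over.mk_left, ← Spec.map_comp, ← CommRingCat.ofHom_comp,
      AlgHom.comp_algebraMap])

theorem specOverMap_comp {A B C : Type u} [CommRing A] [Algebra R A] [CommRing B] [Algebra R B]
    [CommRing C] [Algebra R C] (f : B →ₐ[R] C) (g : A →ₐ[R] B) :
    specOverMap (f.comp g) = specOverMap f ≫ specOverMap g :=
  Over.OverMorphism.ext (Spec.map_comp (CommRingCat.ofHom (g : A →+* B))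
    (CommRingCat.ofHom (f : B →+* C)))

theorem specOverMap_bijective (A B : Type u) [CommRing A] [Algebra R A] [CommRing B]
    [Algebra R B] : Function.Bijective (specOverMap : (A →ₐ[R] B) → _) := by
  constructor
  · intro f g h
    have h1 := congrArg CommaMorphism.left h
    have h2 := Spec.map_injective h1
    ext a
    exact congrArg (fun t => t.hom a) h2
  · intro p
    obtain ⟨φ, hφ⟩ := Spec.map_surjective (R := CommRingCat.of A) (S := CommRingCat.of B) p.left
    have hw := Over.w p
    have h1 : CommRingCat.ofHom (algebraMap R A) ≫ φ = CommRingCat.ofHom (algebraMap R B) := by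
      apply Spec.map_injective
      rw [Spec.map_comp, hφ]
      exact hw
    refine ⟨{ φ.hom with commutes' := fun r => congrArg (fun t => t.hom r) h1 }, ?_⟩
    exact Over.OverMorphism.ext hφ

theorem specOver_card_points {k : Type u} [Field k] [IsAlgClosed k] [CharZero k] [Algebra R k]
    (A : Type u) [CommRing A] [Algebra R A] [Module.Finite R A] (G : Over (Spec (CommRingCat.of R)))
    [GrpObj G] (e : specOver R A ≅ G) :
    Nat.card (specOver R k ⟶ G) = Module.finrank k (k ⊗[R] A) ∧ Finite (specOver R k ⟶ G) := by
  let E (B : Type u) [CommRing B] [Algebra R B] : (A →ₐ[R] B) ≃ (specOver R B ⟶ G) :=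
    (Equiv.ofBijective _ (specOverMap_bijective A B)).trans e.homToEquiv
  have hE (B : Type u) [CommRing B] [Algebra R B] (x : A →ₐ[R] B) :
      E B x = specOverMap x ≫ e.hom := rfl
  -- The group law on `B`-points is carried to algebra maps for all `B` at once, as Cartier's
  -- theorem uses dual numbers.
  let _ (B : Type u) [CommRing B] [Algebra R B] : Group (A →ₐ[R] B) := (E B).group
  have hmul (B : Type u) [CommRing B] [Algebra R B] (x y : A →ₐ[R] B) :
      E B (x * y) = E B x * E B y := (E B).apply_symm_apply _
  obtain ⟨h1, h2⟩ := card_algHom_eq_finrank (R := R) (A₀ := A) (k := k)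
    (fun B C _ _ _ _ f x y => (E C).injective (by
      rw [hmul, hE, specOverMap_comp, Category.assoc, ← hE, hmul, MonObj.comp_mul, hE, hE, hE, hE,
        specOverMap_comp, specOverMap_comp, Category.assoc, Category.assoc]))
  exact ⟨(Nat.card_congr (E k)).symm.trans h1, Finite.of_equiv _ (E k)⟩

theorem exists_specOver_iso (G : Over (Spec (CommRingCat.of R))) [IsAffineHom G.hom] :
    ∃ (A : Type u) (_ : CommRing A) (_ : Algebra R A), Nonempty (specOver R A ≅ G) := by
  have : IsAffine G.left := isAffine_of_isAffineHom G.hom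
  obtain ⟨φ, hφ⟩ := Spec.map_surjective (G.left.isoSpec.inv ≫ G.hom)
  let := φ.hom.toAlgebra
  refine ⟨Γ(G.left, ⊤), inferInstance, inferInstance, ⟨Over.isoMk G.left.isoSpec.symm hφ.symm⟩⟩

/-- The order of a finite flat group scheme over a Noetherian domain of characteristic zero is the
number of its geometric points. -/
theorem finrank_eq_card_points [IsDomain R] [IsNoetherianRing R] {k : Type u} [Field k]
    [IsAlgClosed k] [CharZero k] [Algebra R k] (G : Over (Spec (CommRingCat.of R)))
    [GrpObj G] [IsFinite G.hom] [Flat G.hom] :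
    Finite (specOver R k ⟶ G) ∧ ∀ s, G.hom.finrank s = Nat.card (specOver R k ⟶ G) := by
  obtain ⟨A, _, _, ⟨e⟩⟩ := exists_specOver_iso G
  let p : G.left ⟶ Spec (CommRingCat.of R) := G.hom
  have hp1 : IsFinite p := ‹IsFinite G.hom›
  have hp2 : Flat p := ‹Flat G.hom›
  let e' : Spec (CommRingCat.of A) ⟶ G.left := e.hom.left
  have hiso : IsIso e' := inferInstanceAs (IsIso ((Over.forget _).map e.hom))
  have he : Spec.map (CommRingCat.ofHom (algebraMap R A)) = e' ≫ p := (Over.w e.hom).symm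
  have hfin : IsFinite (Spec.map (CommRingCat.ofHom (algebraMap R A))) := by
    rw [he]; infer_instance
  have hflat : Flat (Spec.map (CommRingCat.ofHom (algebraMap R A))) := by
    rw [he]; infer_instance
  have : Module.Finite R A := by
    rw [IsFinite.SpecMap_iff] at hfin
    exact RingHom.finite_algebraMap.1 hfin
  have : Module.Flat R A := by
    rw [Flat.SpecMap_iff] at hflat
    exact RingHom.flat_algebraMap_iff.1 hflat
  obtain ⟨h1, h2⟩ := specOver_card_points (k := k) A G e
  refine ⟨h2, fun s => ?_⟩
  have hs : p.finrank s = Module.rankAtStalk A s := by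
    rw [← Scheme.Hom.finrank_comp_left_of_isIso e' p, ← he]
    exact Scheme.Hom.finrank_SpecMap_algebraMap R A s
  rw [h1]
  refine hs.trans ?_
  -- The rank is locally constant on the connected `Spec R`, so it may be read off at the image of
  -- `Spec k`.
  let t : PrimeSpectrum k := ⊥
  have h3 := Module.rankAtStalk_baseChange (R := R) (M := A) (S := k) t
  rw [Module.rankAtStalk_eq_finrank_of_free] at h3
  have := Module.finitePresentation_of_finite R A
  have hc : IsLocallyConstant (Module.rankAtStalk (R := R) A) := Module.isLocallyConstant_rankAtStalk
  rw [hc.apply_eq_of_preconnectedSpace s (t.comap (algebraMap R k))]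
  exact h3.symm

/-- A geometric point is fixed by `σ` if and only if its coordinates are. -/
theorem exists_specOverMap_comp_eq_iff {k : Type u} [CommRing k] [Algebra R k]
    (G : Over (Spec (CommRingCat.of R))) [IsAffineHom G.hom] (P : specOver R k ⟶ G) :
    ∃ T : Set k, ∀ σ : k →ₐ[R] k, specOverMap σ ≫ P = P ↔ ∀ y ∈ T, σ y = y := by
  obtain ⟨A, _, _, ⟨e⟩⟩ := exists_specOver_iso G
  obtain ⟨x, hx⟩ := (specOverMap_bijective A k).2 (P ≫ e.inv)
  refine ⟨Set.range x, fun σ => ?_⟩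
  rw [← cancel_mono e.inv, Category.assoc, ← hx, ← specOverMap_comp,
    (specOverMap_bijective A k).1.eq_iff, Set.forall_mem_range, AlgHom.ext_iff]
  rfl

end AffinePoints

/-! ### Exact sequences of finite group schemes over the ring of `π`-integers -/

section Main

open Limits

variable {K : Type u} [Field K] [NumberField K] {π : HeightOneSpectrum (𝓞 K)}

namespace IsShortExactSeq

variable {N J Q : CommGroupScheme π} {f : N ⟶ J} {g : J ⟶ Q}

/-- The torsor square exhibits `J × N → J`, a base change of `N`, as the base change of `g` along
itself. -/
theorem isFinite (h : IsShortExactSeq f g) (hN : IsFinite N.X.hom) :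
    IsFinite (CommGroupScheme.homLeft g) := by
  have hp : IsPullback (pullback.fst J.X.hom N.X.hom)
      (fst J.X N.X * snd J.X N.X ≫ f.hom.hom.hom).left
      (CommGroupScheme.homLeft g) (CommGroupScheme.homLeft g) :=
    (isPullback_fst_of_isKernel h.isKernel).map (Over.forget _)
  have := h.flat
  have := h.surjective
  have := h.quasiCompact
  exact isFinite_of_isPullback hp

theorem pointsMap_comp_eq_one (h : IsShortExactSeq f g) (P : geometricPoint π ⟶ N.X) :
    pointsMap g (pointsMap f P) = 1 := by
  change (P ≫ f.hom.hom.hom) ≫ g.hom.hom.hom = 1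
  have hfg : f.hom.hom.hom ≫ g.hom.hom.hom = 1 := h.isKernel.w
  rw [Category.assoc, hfg, MonObj.comp_one]

theorem ker_pointsMap (h : IsShortExactSeq f g) : (pointsMap g).ker = (pointsMap f).range := by
  ext P
  constructor
  · intro hP
    exact ⟨h.isKernel.lift P (toUnit _) hP, h.isKernel.lift_fst _ _ _⟩
  · rintro ⟨P', rfl⟩
    exact h.pointsMap_comp_eq_one P'

theorem pointsMap_injective (h : IsShortExactSeq f g) : Function.Injective (pointsMap f) :=
  fun _ _ hab => h.isKernel.hom_ext hab (toUnit_unique _ _)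

end IsShortExactSeq

/-- Geometric points lift along finite surjective morphisms. -/
theorem pointsMap_surjective {J Q : CommGroupScheme π} (g : J ⟶ Q)
    [IsFinite (CommGroupScheme.homLeft g)] [Surjective (CommGroupScheme.homLeft g)] :
    Function.Surjective (pointsMap g) := by
  intro P
  let p : Spec (CommRingCat.of (AlgebraicClosure K)) ⟶ Q.X.left := P.left
  let q := pullback.snd (CommGroupScheme.homLeft g) p
  have hq : Surjective q := inferInstance
  have hfin : IsFinite q := inferInstance
  obtain ⟨z, -⟩ := q.surjective default
  have : CompactSpace (pullback (CommGroupScheme.homLeft g) p :) :=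
    QuasiCompact.compactSpace_of_compactSpace q
  -- The fibre over the given point is nonempty and finite over an algebraically closed field, so a
  -- closed point of it is rational.
  obtain ⟨x, -, hx⟩ := (isClosed_univ (X := (pullback (CommGroupScheme.homLeft g) p :)))
    |>.exists_closed_singleton ⟨z, trivial⟩
  let t := pointOfClosedPoint q x hx ≫ pullback.fst (CommGroupScheme.homLeft g) p
  have ht : t ≫ CommGroupScheme.homLeft g = p := by
    rw [Category.assoc, pullback.condition, pointOfClosedPoint_comp_assoc]
  refine ⟨Over.homMk t ?_, Over.OverMorphism.ext ht⟩
  have h1 : CommGroupScheme.homLeft g ≫ Q.X.hom = J.X.hom := Over.w g.hom.hom.hom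
  have h2 : p ≫ Q.X.hom = (geometricPoint π).hom := Over.w P
  rw [← h1, ← h2, ← ht, Category.assoc]
  rfl

theorem finrank_eq_card_geometricPoints (G : CommGroupScheme π) (h1 : IsFinite G.X.hom)
    (h2 : Flat G.X.hom) :
    Finite (geometricPoint π ⟶ G.X) ∧
      ∀ s, G.X.hom.finrank s = Nat.card (geometricPoint π ⟶ G.X) :=
  finrank_eq_card_points (R := PiInteger π) (k := AlgebraicClosure K) G.X

theorem exists_card_geometricPoints_eq_pow {ℓ : ℕ} {i : ℝ} {G : CommGroupScheme π}
    (h : IsLevelGroupScheme π ℓ i G) : ∃ n, Nat.card (geometricPoint π ⟶ G.X) = ℓ ^ n := by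
  obtain ⟨n, hn⟩ := h.order
  let s : Spec (CommRingCat.of (PiInteger π)) := (⊥ : PrimeSpectrum (PiInteger π))
  exact ⟨n, ((finrank_eq_card_geometricPoints G h.isFinite h.flat).2 s).symm.trans (hn s)⟩

theorem isLevelGroupScheme_of_card {ℓ : ℕ} {i : ℝ} {G : CommGroupScheme π}
    (h1 : IsFinite G.X.hom) (h2 : Flat G.X.hom)
    (h3 : ∃ n, Nat.card (geometricPoint π ⟶ G.X) = ℓ ^ n) (h4 : G.IsRamifiedOfLevelAt π i) :
    IsLevelGroupScheme π ℓ i G := by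
  obtain ⟨n, hn⟩ := h3
  exact ⟨h1, h2, ⟨n, fun s => ((finrank_eq_card_geometricPoints G h1 h2).2 s).trans hn⟩, h4⟩

theorem isRamifiedOfLevelAt_iff {G : CommGroupScheme π} {i : ℝ} :
    G.IsRamifiedOfLevelAt π i ↔
      ∀ (e : AlgebraicClosure K →ₐ[K] AlgebraicClosure (π.adicCompletion K)) (v : ℝ), i < v →
        ∀ σ ∈ absoluteUpperRamificationGroup (π.adicCompletionIntegers K) (π.adicCompletion K) v,
          ∀ P : geometricPoint π ⟶ G.X, galoisRep G (galoisRestrict e σ) P = P :=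
  forall₃_congr fun e _ _ => forall₂_congr fun _ _ =>
    (MonoidHom.mem_ker (f := (galoisRep G).comp (galoisRestrict e))).trans MulEquiv.ext_iff

theorem isRamifiedOfLevelAt_of_injective {G H : CommGroupScheme π} {i : ℝ} (f : G ⟶ H)
    (hf : Function.Injective (pointsMap f)) (h : H.IsRamifiedOfLevelAt π i) :
    G.IsRamifiedOfLevelAt π i := by
  rw [isRamifiedOfLevelAt_iff] at h ⊢
  intro e v hv σ hσ P
  apply hf
  rw [pointsMap_galoisRep, h e v hv σ hσ]

theorem isRamifiedOfLevelAt_of_surjective {G H : CommGroupScheme π} {i : ℝ} (f : G ⟶ H)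
    (hf : Function.Surjective (pointsMap f)) (h : G.IsRamifiedOfLevelAt π i) :
    H.IsRamifiedOfLevelAt π i := by
  rw [isRamifiedOfLevelAt_iff] at h ⊢
  intro e v hv σ hσ P
  obtain ⟨P, rfl⟩ := hf P
  rw [← pointsMap_galoisRep, h e v hv σ hσ]

theorem exists_galoisRep_eq_iff (G : CommGroupScheme π) [IsAffineHom G.X.hom]
    (P : geometricPoint π ⟶ G.X) :
    ∃ T : Set (AlgebraicClosure K), ∀ σ : AlgebraicClosure K ≃ₐ[K] AlgebraicClosure K,
      galoisRep G σ P = P ↔ ∀ y ∈ T, σ y = y := by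
  obtain ⟨T, hT⟩ := exists_specOverMap_comp_eq_iff (R := PiInteger π) G.X P
  exact ⟨T, fun σ => hT ((σ : AlgebraicClosure K →ₐ[K] AlgebraicClosure K).restrictScalars _)⟩

/-- Upper ramification groups of positive index act trivially on a geometric point as soon as
their `ℓ`-powers do, for `ℓ` prime to the residue characteristic. -/
theorem galoisRep_eq_of_galoisRep_pow_eq {G : CommGroupScheme π} [IsAffineHom G.X.hom]
    {ℓ : ℕ} (hℓ : ℓ.Prime) (hπℓ : (ℓ : 𝓞 K) ∉ π.asIdeal)
    (e : AlgebraicClosure K →ₐ[K] AlgebraicClosure (π.adicCompletion K)) {v : ℝ} (hv : 0 < v)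
    {σ : AlgebraicClosure (π.adicCompletion K) ≃ₐ[π.adicCompletion K]
      AlgebraicClosure (π.adicCompletion K)}
    (hσ : σ ∈ absoluteUpperRamificationGroup (π.adicCompletionIntegers K) (π.adicCompletion K) v)
    {P : geometricPoint π ⟶ G.X} {n : ℕ}
    (hP : galoisRep G (galoisRestrict e σ ^ (ℓ ^ n)) P = P) :
    galoisRep G (galoisRestrict e σ) P = P := by
  obtain ⟨T, hT⟩ := exists_galoisRep_eq_iff G P
  rw [hT] at hP ⊢
  intro y hy
  apply e.toRingHom.injective
  refine (galoisRestrict_commutes e σ y).trans ?_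
  refine eq_of_pow_eq_of_mem_absoluteUpperRamificationGroup hv hσ hℓ
    (isUnit_natCast_adicCompletionIntegers π hπℓ) (n := n) ?_
  rw [← galoisRestrict_commutes, map_pow]
  exact congrArg e (hP y hy)

theorem isRamifiedOfLevelAt_of_isShortExactSeq {N J Q : CommGroupScheme π} {f : N ⟶ J} {g : J ⟶ Q}
    (h : IsShortExactSeq f g) [IsAffineHom J.X.hom] {ℓ : ℕ} (hℓ : ℓ.Prime)
    (hπℓ : (ℓ : 𝓞 K) ∉ π.asIdeal) {i : ℝ} (hi : 0 ≤ i) {n : ℕ}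
    (hn : Nat.card (geometricPoint π ⟶ N.X) = ℓ ^ n)
    (hN : N.IsRamifiedOfLevelAt π i) (hQ : Q.IsRamifiedOfLevelAt π i) :
    J.IsRamifiedOfLevelAt π i := by
  rw [isRamifiedOfLevelAt_iff] at hN hQ ⊢
  intro e v hv σ hσ P
  set τ := galoisRestrict e σ with hτ
  have hmem : P⁻¹ * galoisRep J τ P ∈ (pointsMap g).ker := by
    rw [MonoidHom.mem_ker, map_mul, map_inv, pointsMap_galoisRep, hQ e v hv σ hσ, inv_mul_cancel]
  rw [h.ker_pointsMap] at hmem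
  obtain ⟨Z, hZ⟩ := hmem
  have h1 : galoisRep J τ P = P * pointsMap f Z := by rw [hZ, mul_inv_cancel_left]
  have h2 : galoisRep J τ (pointsMap f Z) = pointsMap f Z := by
    rw [← pointsMap_galoisRep, hN e v hv σ hσ]
  have hk : ∀ k : ℕ, galoisRep J (τ ^ k) P = P * pointsMap f Z ^ k := by
    intro k
    induction k with
    | zero => rw [pow_zero, pow_zero, map_one, mul_one]; rfl
    | succ k ih =>
      rw [pow_succ', map_mul, MulAut.mul_apply, ih, map_mul, h1, map_pow, h2, mul_assoc, ← pow_succ']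
  refine galoisRep_eq_of_galoisRep_pow_eq hℓ hπℓ e (hi.trans_lt hv) hσ (n := n) ?_
  -- `Z` is killed by the order `ℓ ^ n` of the group of points of `N`.
  rw [hk, ← map_pow, ← hn, pow_card_eq_one', map_one, mul_one]

end Main

theorem proposition2p6 {K : Type*} [Field K] [NumberField K] (π : HeightOneSpectrum (𝓞 K))
    (ℓ : ℕ) (hℓ : ℓ.Prime) (hπℓ : (ℓ : 𝓞 K) ∉ π.asIdeal) (i : ℝ) (hi : 0 ≤ i) :
    (∀ (J'' J J' : CommGroupScheme π) (f : J'' ⟶ J) (g : J ⟶ J'), IsShortExactSeq f g →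
      IsLevelGroupScheme π ℓ i J'' → IsLevelGroupScheme π ℓ i J' →
        IsLevelGroupScheme π ℓ i J) ∧
    (∀ (H J : CommGroupScheme π) (f : H ⟶ J), IsClosedImmersion (CommGroupScheme.homLeft f) →
      Flat H.X.hom → IsLevelGroupScheme π ℓ i J →
        IsLevelGroupScheme π ℓ i H ∧
        ∀ (Q : CommGroupScheme π) (g : J ⟶ Q), IsShortExactSeq f g →
          IsLevelGroupScheme π ℓ i Q) := by
  constructor
  · intro J'' J J' f g h h'' h'
    have hg := h.isFinite h''.isFinite
    have hgs := h.surjective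
    have hgf := h.flat
    have hw : CommGroupScheme.homLeft g ≫ J'.X.hom = J.X.hom := Over.w g.hom.hom.hom
    have hfin : IsFinite J.X.hom := by
      have := h'.isFinite
      rw [← hw]; infer_instance
    have hflat : Flat J.X.hom := by
      have := h'.flat
      rw [← hw]; infer_instance
    obtain ⟨a, ha⟩ := exists_card_geometricPoints_eq_pow h''
    obtain ⟨b, hb⟩ := exists_card_geometricPoints_eq_pow h'
    refine isLevelGroupScheme_of_card hfin hflat ⟨a + b, ?_⟩
      (isRamifiedOfLevelAt_of_isShortExactSeq h hℓ hπℓ hi ha h''.level h'.level)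
    -- The points of `J''` are the kernel and those of `J'` the image of `pointsMap g`.
    rw [pow_add, ← ha, ← hb, ← Subgroup.card_mul_index (pointsMap g).ker, Subgroup.index_ker,
      h.ker_pointsMap,
      ← Nat.card_congr (MonoidHom.ofInjective h.pointsMap_injective).toEquiv,
      MonoidHom.range_eq_top.2 (pointsMap_surjective g), Subgroup.card_top]
  · intro H J f hf hflat hJ
    obtain ⟨n, hn⟩ := exists_card_geometricPoints_eq_pow hJ
    have hJfin := hJ.isFinite
    have hHfin : IsFinite H.X.hom := by
      have hw : CommGroupScheme.homLeft f ≫ J.X.hom = H.X.hom := Over.w f.hom.hom.hom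
      rw [← hw]; infer_instance
    have hinj : Function.Injective (pointsMap f) := fun a b hab =>
      Over.OverMorphism.ext ((cancel_mono (CommGroupScheme.homLeft f)).1
        (congrArg CommaMorphism.left hab))
    have hdvd := Subgroup.card_dvd_of_injective (pointsMap f) hinj
    rw [hn, Nat.dvd_prime_pow hℓ] at hdvd
    obtain ⟨a, -, ha⟩ := hdvd
    refine ⟨isLevelGroupScheme_of_card hHfin hflat ⟨a, ha⟩
      (isRamifiedOfLevelAt_of_injective f hinj hJ.level), fun Q g h => ?_⟩
    have hg := h.isFinite hHfin
    have hgs := h.surjective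
    have hgf := h.flat
    let p : J.X.left ⟶ Q.X.left := CommGroupScheme.homLeft g
    let q : Q.X.left ⟶ Spec (CommRingCat.of (PiInteger π)) := Q.X.hom
    have hw : p ≫ q = J.X.hom := Over.w g.hom.hom.hom
    have hQfin : IsFinite q := by
      have : IsFinite (p ≫ q) := hw ▸ hJfin
      exact isFinite_of_isFinite_comp p q
    have hQflat : Flat q := by
      have : Flat (p ≫ q) := hw ▸ hJ.flat
      exact flat_of_flat_comp_of_surjective p q
    have hsurj := pointsMap_surjective g
    have hdvd := Subgroup.card_dvd_of_surjective (pointsMap g) hsurj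
    rw [hn, Nat.dvd_prime_pow hℓ] at hdvd
    obtain ⟨b, -, hb⟩ := hdvd
    exact isLevelGroupScheme_of_card hQfin hQflat ⟨b, hb⟩
      (isRamifiedOfLevelAt_of_surjective g hsurj hJ.level)
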